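/- Let $\mathbb{H}=\{(x_1,x_2)\in\mathbb{Z}^2 : x_2\ge 0\}$, let $L_N=\{(a,N): a\in\mathbb{Z}\}$ for integers $N\ge 0$, and let $P_z$ be the law of the simple random walk $(S_n)_{n\ge 0}$ on $\mathbb{Z}^2$ started at $z$. For $A\subset\mathbb{Z}^2$ put $\bar\tau_A=\min\{n\ge 0: S_n\in A\}$ (with $\bar\tau_A=\infty$ if $A$ is never hit). For $B\subset\mathbb{H}$ and $x\in B$ let $$\bar{\mathcal H}_{B,N}(x)=\sum_{z\in L_N\setminus B}P_z\bigl(\bar\tau_{B\cup L_0}<\infty,\ S_{\bar\tau_{B\cup L_0}}=x\bigr),\qquad \bar{\mathcal H}_B(x)=\lim_{N\to\infty}\bar{\mathcal H}_{B,N}(x);$$ the limit $\bar{\mathcal H}_B(x)$ is the stationary harmonic measure of $x$ with respect to $B$. For $a\in\mathbb{Z}$ let $h_a\in[0,\infty]$ be the supremum of all integers $m\ge 0$ such that $(a,1),\dots,(a,m)\in B$. The set $B$ has horizontal super-linear growth if there are constants $c\in(0,\infty)$ and $M<\infty$ such that $h_a\ge |c\,a|$ for all $a\in\mathbb{Z}$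 with $|a|\ge M$. Theorem. If $B\subset\mathbb{H}$ has horizontal super-linear growth, then for every $x\in B$ the limit $\bar{\mathcal H}_B(x)$ exists and $\bar{\mathcal H}_B(x)=0$. In particular, for $B^0=\bigcup_{n\in\mathbb{Z}}\{(n,k): k=0,1,\dots,2^{|n|}\}$ one has $\bar{\mathcal H}_{B^0}(x)=0$ for all $x\in B^0$. -/

import Mathlib

open Filter Topology MeasureTheory
open scoped ENNReal

/-- The upper half planar lattice, including the horizontal axis. -/
def upperHalfLattice : Set (ℤ × ℤ) := {x | 0 ≤ x.2}

/-- The horizontal line of height `N`. -/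
def horizontalLine (N : ℕ) : Set (ℤ × ℤ) := {x | x.2 = (N : ℤ)}

/-- The four unit steps of the planar lattice. -/
def unitSteps : Finset (ℤ × ℤ) := {(1, 0), (-1, 0), (0, 1), (0, -1)}

theorem unitSteps_nonempty : unitSteps.Nonempty := ⟨(1, 0), by simp [unitSteps]⟩

/-- The law of one step of simple random walk: uniform on the four unit steps. -/
noncomputable def stepLaw : Measure (ℤ × ℤ) :=
  (PMF.uniformOfFinset unitSteps unitSteps_nonempty).toMeasure

instance stepLaw_isProbabilityMeasure : IsProbabilityMeasure stepLaw := by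
  unfold stepLaw
  infer_instance

/-- The law of the sequence of steps: independent steps, each with law `stepLaw`. -/
noncomputable def stepsMeasure : Measure (ℕ → ℤ × ℤ) := Measure.infinitePi (fun _ => stepLaw)

/-- The position at time `n` of the walk started at `z` with step sequence `ω`. -/
def walk (z : ℤ × ℤ) (ω : ℕ → ℤ × ℤ) (n : ℕ) : ℤ × ℤ := z + ∑ i ∈ Finset.range n, ω i

/-- The probability `P_z(E)` of a set `E` of trajectories for simple random walk started at `z`. -/
noncomputable def walkProb (z : ℤ × ℤ) (E : Set (ℕ → ℤ × ℤ)) : ℝ≥0∞ :=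
  stepsMeasure {ω | walk z ω ∈ E}

/-- The first hitting time `min {n ≥ 0 | s n ∈ A}` of a set by a trajectory, `⊤` if there is none. -/
noncomputable def hitTime (A : Set (ℤ × ℤ)) (s : ℕ → ℤ × ℤ) : ℕ∞ :=
  ⨅ (n : ℕ) (_ : s n ∈ A), (n : ℕ∞)

/-- The trajectories that hit `A`, and do so for the first time at the point `x`. -/
def firstHitAt (A : Set (ℤ × ℤ)) (x : ℤ × ℤ) : Set (ℕ → ℤ × ℤ) :=
  {s | ∃ n : ℕ, hitTime A s = n ∧ s n = x}

/-- The expected number of walks, one started from each point of the line of height `N` outside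
`B`, that first hit `B` or the horizontal axis at the point `x`. -/
noncomputable def harmonicMeasureFrom (B : Set (ℤ × ℤ)) (N : ℕ) (x : ℤ × ℤ) : ℝ≥0∞ :=
  ∑' z : ↥(horizontalLine N \ B), walkProb z (firstHitAt (B ∪ horizontalLine 0) x)

/-- The stationary harmonic measure of `x` with respect to `B` exists and equals `h`. -/
def HasStationaryHarmonicMeasure (B : Set (ℤ × ℤ)) (x : ℤ × ℤ) (h : ℝ≥0∞) : Prop :=
  Tendsto (fun N : ℕ => harmonicMeasureFrom B N x) atTop (𝓝 h)

/-- The supremum of all `m ≥ 0` such that the lattice points `(a, 1), …, (a, m)` lie in `B`. -/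
noncomputable def columnHeight (B : Set (ℤ × ℤ)) (a : ℤ) : ℝ≥0∞ :=
  ⨆ (m : ℕ) (_ : ∀ k : ℤ, 1 ≤ k → k ≤ (m : ℤ) → (a, k) ∈ B), (m : ℝ≥0∞)

/-- Horizontal super-linear growth: outside a bounded interval of abscissas, the column height is
at least a fixed positive multiple of the distance to the vertical axis. -/
def HasHorizontalSuperLinearGrowth (B : Set (ℤ × ℤ)) : Prop :=
  ∃ c : ℝ, 0 < c ∧ ∃ M : ℝ, ∀ a : ℤ, M ≤ |(a : ℝ)| → ENNReal.ofReal |c * (a : ℝ)| ≤ columnHeight B a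

/-- The union over all integers `n` of the columns `{(n, k) | 0 ≤ k ≤ 2 ^ |n|}`. -/
def exponentialColumns : Set (ℤ × ℤ) := {x | 0 ≤ x.2 ∧ x.2 ≤ 2 ^ x.1.natAbs}

/-!
Horizontal super-linear growth confines the complement of `B` in the open upper half plane to a
cone `{|x₁| ≤ C x₂}`. By reversibility of the walk, `harmonicMeasureFrom B N x` is the expected
number of visits to the line of height `N` by a walk that starts with a step from `x` and is killed
on `B` and on the axis. In the whole half plane this number stays of order one as `N → ∞`: the line
is reached with probability of order `1 / N` and then visited about `4 N` times. In a cone with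
opening angle less than `π` the line is reached with probability `o(1 / N)`, so the limit is `0`.

Quantitatively, `conePotential` is an explicit nonnegative superharmonic function on the cone,
`u = K (y + 1) + G(y) - x² / (y + 1)`, where `G = harmonicSum` grows like `y log y`; the term
`x² / (y + 1)` pays for the convexity of `G`. The function `min (l u) (4 y) (4 N)`, with
`l = 4 N / G(N) → 0`, exceeds its average over the neighbours by at least `1` on the line of height
`N` and is superharmonic elsewhere off `B` (`lineSupersolution_superharmonic`). The duality
`tsum_walkProb_firstHitAt_le` turns this into `harmonicMeasureFrom B N x ≤ l · const`. It replaces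
the reversal of paths by a summation by parts for the recursion, given by the Markov property at
time `1`, that the probabilities of first hitting at time `n` satisfy.
-/

/-! ### The first step of the walk -/

/-- The step sequence with first step `p.1` and later steps `p.2`. -/
def consStep (p : (ℤ × ℤ) × (ℕ → ℤ × ℤ)) : ℕ → ℤ × ℤ
  | 0 => p.1
  | n + 1 => p.2 n

theorem measurable_consStep : Measurable consStep := by
  refine measurable_pi_iff.2 fun n => ?_
  cases n with
  | zero => exact measurable_fst
  | succ n => exact (measurable_pi_apply n).comp measurable_snd

theorem walk_consStep_succ (z e : ℤ × ℤ) (ω : ℕ → ℤ × ℤ) (n : ℕ) :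
    walk z (consStep (e, ω)) (n + 1) = walk (z + e) ω n := by
  simp only [walk, Finset.sum_range_succ', consStep]
  abel

theorem stepsMeasure_range_pi (n : ℕ) (t : ℕ → Set (ℤ × ℤ)) :
    stepsMeasure (Set.pi (Finset.range n) t) = ∏ i ∈ Finset.range n, stepLaw (t i) :=
  Measure.infinitePi_pi _ fun i _ => (Set.to_countable (t i)).measurableSet

instance stepsMeasure_isProbabilityMeasure : IsProbabilityMeasure stepsMeasure := by
  unfold stepsMeasure
  infer_instance

/-- An independent first step followed by an independent step sequence is again a sequence of
independent steps. -/
theorem map_consStep : (stepLaw.prod stepsMeasure).map consStep = stepsMeasure := by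
  refine Measure.eq_infinitePi _ fun s t _ => ?_
  classical
  obtain ⟨n, hn⟩ : ∃ n, s ⊆ Finset.range (n + 1) :=
    ⟨s.sup id, fun i hi => Finset.mem_range.2 (Nat.lt_succ_of_le (Finset.le_sup (f := id) hi))⟩
  -- Unconstrained coordinates are filled in by `univ`, so that `s` becomes an initial segment.
  set t' : ℕ → Set (ℤ × ℤ) := fun i => if i ∈ s then t i else Set.univ with ht'
  have hpi : Set.pi (s : Set ℕ) t = Set.pi (Finset.range (n + 1) : Set ℕ) t' := by
    ext ω
    simp only [Set.mem_pi, Finset.mem_coe]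
    constructor
    · intro h i _
      by_cases hi : i ∈ s
      · simpa [ht', hi] using h i hi
      · simp [ht', hi]
    · intro h i hi
      simpa [ht', hi] using h i (hn hi)
  have hprod : ∏ i ∈ s, stepLaw (t i) = ∏ i ∈ Finset.range (n + 1), stepLaw (t' i) := by
    rw [← Finset.prod_subset hn]
    · exact Finset.prod_congr rfl fun i hi => by simp [ht', hi]
    · intro i _ hi
      simp [ht', hi]
  have hpre : consStep ⁻¹' Set.pi (Finset.range (n + 1) : Set ℕ) t' =
      t' 0 ×ˢ Set.pi (Finset.range n : Set ℕ) fun i => t' (i + 1) := by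
    ext ⟨e, ω⟩
    simp only [Set.mem_preimage, Set.mem_pi, Finset.mem_coe, Finset.mem_range, Set.mem_prod]
    constructor
    · exact fun h => ⟨h 0 (Nat.succ_pos n), fun i hi => h (i + 1) (Nat.succ_lt_succ hi)⟩
    · rintro ⟨h0, h⟩ (_ | i) hi
      · exact h0
      · exact h i (Nat.lt_of_succ_lt_succ hi)
  have hmeas : MeasurableSet (Set.pi (Finset.range (n + 1) : Set ℕ) t') :=
    MeasurableSet.pi (Finset.countable_toSet _) fun i _ => (Set.to_countable (t' i)).measurableSet
  rw [hpi, hprod, Measure.map_apply measurable_consStep hmeas, hpre, Measure.prod_prod,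
    stepsMeasure_range_pi, Finset.prod_range_succ', mul_comm]

theorem measurable_walk (z : ℤ × ℤ) : Measurable (walk z) := by
  refine measurable_pi_iff.2 fun n => ?_
  exact measurable_const.add (Finset.measurable_sum _ fun i _ => measurable_pi_apply i)

theorem stepLaw_singleton (e : ℤ × ℤ) : stepLaw {e} = if e ∈ unitSteps then 4⁻¹ else 0 := by
  have hcard : unitSteps.card = 4 := by decide
  rw [stepLaw, PMF.toMeasure_apply_singleton _ _ (measurableSet_singleton e),
    PMF.uniformOfFinset_apply, hcard]
  norm_num

/-- The Markov property at time `1`. -/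
theorem walkProb_shift (z : ℤ × ℤ) {E : Set (ℕ → ℤ × ℤ)} (hE : MeasurableSet E) :
    walkProb z {s | (fun k => s (k + 1)) ∈ E} = ∑ e ∈ unitSteps, 4⁻¹ * walkProb (z + e) E := by
  have hshift : Measurable fun (s : ℕ → ℤ × ℤ) (k : ℕ) => s (k + 1) :=
    measurable_pi_iff.2 fun k => measurable_pi_apply (k + 1)
  have hS : MeasurableSet {ω | walk z ω ∈ {s | (fun k => s (k + 1)) ∈ E}} :=
    measurable_walk z (hshift hE)
  rw [walkProb, ← map_consStep, Measure.map_apply measurable_consStep hS,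
    Measure.prod_apply (measurable_consStep hS), lintegral_countable',
    tsum_eq_sum (s := unitSteps)]
  · refine Finset.sum_congr rfl fun e he => ?_
    rw [stepLaw_singleton, if_pos he, mul_comm]
    simp only [Set.preimage_ofPred_eq, Set.mem_ofPred_eq, walk_consStep_succ, walkProb]
  · intro e he
    rw [stepLaw_singleton, if_neg he, mul_zero]

/-! ### Duality between first hitting and superharmonic functions -/

/-- The trajectories that are at `x` at time `n` and avoid `A` before time `n`. -/
def atAfterAvoiding (A : Set (ℤ × ℤ)) (x : ℤ × ℤ) (n : ℕ) : Set (ℕ → ℤ × ℤ) :=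
  {s | s n = x ∧ ∀ k < n, s k ∉ A}

theorem measurableSet_atAfterAvoiding (A : Set (ℤ × ℤ)) (x : ℤ × ℤ) (n : ℕ) :
    MeasurableSet (atAfterAvoiding A x n) := by
  have hset (B : Set (ℤ × ℤ)) (k : ℕ) : MeasurableSet {s : ℕ → ℤ × ℤ | s k ∈ B} :=
    measurable_pi_apply k (Set.to_countable B).measurableSet
  have h : atAfterAvoiding A x n =
      {s | s n ∈ ({x} : Set (ℤ × ℤ))} ∩ ⋂ k, ⋂ _ : k < n, {s | s k ∈ Aᶜ} := by
    ext s
    simp [atAfterAvoiding]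
  rw [h]
  exact (hset _ n).inter (MeasurableSet.iInter fun k => MeasurableSet.iInter fun _ => hset _ k)

theorem walkProb_mono (z : ℤ × ℤ) {E E' : Set (ℕ → ℤ × ℤ)} (h : E ⊆ E') :
    walkProb z E ≤ walkProb z E' :=
  measure_mono fun _ hω => h hω

theorem walkProb_firstHitAt_le (A : Set (ℤ × ℤ)) (x z : ℤ × ℤ) :
    walkProb z (firstHitAt A x) ≤ ∑' n, walkProb z (atAfterAvoiding A x n) := by
  refine le_trans (walkProb_mono z (E' := ⋃ n, atAfterAvoiding A x n) ?_) ?_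
  · rintro s ⟨n, hn, hx⟩
    refine Set.mem_iUnion.2 ⟨n, hx, fun k hk hA => ?_⟩
    have h : hitTime A s ≤ k := iInf₂_le k hA
    rw [hn] at h
    exact absurd (by exact_mod_cast h) (not_le.2 hk)
  · have h : {ω | walk z ω ∈ ⋃ n, atAfterAvoiding A x n} =
        ⋃ n, {ω | walk z ω ∈ atAfterAvoiding A x n} := by
      ext ω
      simp
    rw [walkProb, h]
    exact measure_iUnion_le _

theorem walkProb_atAfterAvoiding_zero (A : Set (ℤ × ℤ)) {x z : ℤ × ℤ} (h : z ≠ x) :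
    walkProb z (atAfterAvoiding A x 0) = 0 := by
  simp [walkProb, atAfterAvoiding, walk, h]

theorem walkProb_le_one (z : ℤ × ℤ) (E : Set (ℕ → ℤ × ℤ)) : walkProb z E ≤ 1 := prob_le_one

theorem walkProb_atAfterAvoiding_succ_of_mem {A : Set (ℤ × ℤ)} (x : ℤ × ℤ) {z : ℤ × ℤ}
    (hz : z ∈ A) (n : ℕ) : walkProb z (atAfterAvoiding A x (n + 1)) = 0 := by
  have h : {ω | walk z ω ∈ atAfterAvoiding A x (n + 1)} = ∅ := by
    refine Set.eq_empty_of_forall_notMem fun ω hω => hω.2 0 (Nat.succ_pos n) ?_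
    simpa [walk] using hz
  rw [walkProb, h, measure_empty]

theorem walkProb_atAfterAvoiding_succ_le (A : Set (ℤ × ℤ)) (x z : ℤ × ℤ) (n : ℕ) :
    walkProb z (atAfterAvoiding A x (n + 1)) ≤
      ∑ e ∈ unitSteps, 4⁻¹ * walkProb (z + e) (atAfterAvoiding A x n) := by
  rw [← walkProb_shift z (measurableSet_atAfterAvoiding A x n)]
  exact walkProb_mono z fun s hs => ⟨hs.1, fun k hk => hs.2 (k + 1) (Nat.succ_lt_succ hk)⟩

/-- Summation by parts: the averaging operator moves from the hitting probabilities to the test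
function `F`. -/
theorem tsum_mul_walkProb_succ_le (A : Set (ℤ × ℤ)) (x : ℤ × ℤ) (F : ℤ × ℤ → ℝ≥0∞) (n : ℕ) :
    ∑' z, F z * walkProb z (atAfterAvoiding A x (n + 1)) ≤
      ∑' z, (∑ e ∈ unitSteps, 4⁻¹ * F (z - e)) * walkProb z (atAfterAvoiding A x n) := by
  calc ∑' z, F z * walkProb z (atAfterAvoiding A x (n + 1))
      ≤ ∑' z, ∑ e ∈ unitSteps, 4⁻¹ * F z * walkProb (z + e) (atAfterAvoiding A x n) := by
        refine ENNReal.tsum_le_tsum fun z => ?_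
        refine (mul_le_mul_right (walkProb_atAfterAvoiding_succ_le A x z n) (F z)).trans_eq ?_
        rw [Finset.mul_sum]
        exact Finset.sum_congr rfl fun e _ => by ring
    _ = ∑ e ∈ unitSteps, ∑' z, 4⁻¹ * F z * walkProb (z + e) (atAfterAvoiding A x n) :=
        Summable.tsum_finsetSum fun _ _ => ENNReal.summable
    _ = ∑ e ∈ unitSteps, ∑' z, 4⁻¹ * F (z - e) * walkProb z (atAfterAvoiding A x n) := by
        refine Finset.sum_congr rfl fun e _ => ?_
        rw [← (Equiv.addRight e).tsum_eq fun z =>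
          4⁻¹ * F (z - e) * walkProb z (atAfterAvoiding A x n)]
        simp
    _ = ∑' z, ∑ e ∈ unitSteps, 4⁻¹ * F (z - e) * walkProb z (atAfterAvoiding A x n) :=
        (Summable.tsum_finsetSum fun _ _ => ENNReal.summable).symm
    _ = _ := tsum_congr fun z => (Finset.sum_mul _ _ _).symm

/-- If off `A` the function `F` exceeds its average over the neighbours by at least the indicator
of `V`, then the average of `F` over the neighbours of `x` bounds the total probability, over
starting points in `V`, of first hitting `A` at `x`. By reversibility this total is an expected
number of visits to `V`, for which `F` is a supersolution. -/
theorem tsum_walkProb_firstHitAt_le {A V : Set (ℤ × ℤ)} {x : ℤ × ℤ} (hx : x ∉ V)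
    (hVA : Disjoint V A) (F : ℤ × ℤ → ℝ≥0∞)
    (hF : ∀ z, z ∉ A →
      ∑ e ∈ unitSteps, 4⁻¹ * F (z - e) + V.indicator (fun _ => 1) z ≤ F z) :
    ∑' z : V, walkProb z (firstHitAt A x) ≤ ∑ e ∈ unitSteps, 4⁻¹ * F (x - e) := by
  set φ : ℕ → ℤ × ℤ → ℝ≥0∞ := fun n z => walkProb z (atAfterAvoiding A x n)
  have hstep (n : ℕ) : ∑' z, F z * φ (n + 2) z + ∑' z : V, φ (n + 1) z ≤
      ∑' z, F z * φ (n + 1) z := by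
    rw [tsum_subtype V (φ (n + 1))]
    refine (add_le_add_left (tsum_mul_walkProb_succ_le A x F (n + 1)) _).trans ?_
    rw [← ENNReal.tsum_add]
    refine ENNReal.tsum_le_tsum fun z => ?_
    by_cases hz : z ∈ A
    · have hzV : z ∉ V := fun h => hVA.ne_of_mem h hz rfl
      simp [hzV, φ, walkProb_atAfterAvoiding_succ_of_mem x hz n]
    · have hV : V.indicator (φ (n + 1)) z = V.indicator (fun _ => 1) z * φ (n + 1) z := by
        by_cases h : z ∈ V <;> simp [h]
      rw [hV, ← add_mul]
      exact mul_le_mul_left (hF z hz) _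
  have hpartial (n : ℕ) : ∑' z, F z * φ (n + 1) z + ∑ i ∈ Finset.range n, ∑' z : V, φ (i + 1) z ≤
      ∑' z, F z * φ 1 z := by
    induction n with
    | zero => simp
    | succ n ih =>
      refine le_trans ?_ ih
      rw [Finset.sum_range_succ, add_comm (∑ i ∈ Finset.range n, _), ← add_assoc]
      exact add_le_add_left (hstep n) _
  have hone : ∑' z, F z * φ 1 z ≤ ∑ e ∈ unitSteps, 4⁻¹ * F (x - e) := by
    refine (tsum_mul_walkProb_succ_le A x F 0).trans ?_
    rw [tsum_eq_single x fun z hz => by rw [walkProb_atAfterAvoiding_zero A hz, mul_zero]]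
    exact mul_le_of_le_one_right' (walkProb_le_one _ _)
  calc ∑' z : V, walkProb z (firstHitAt A x)
      ≤ ∑' z : V, ∑' n, φ n z := ENNReal.tsum_le_tsum fun z => walkProb_firstHitAt_le A x z
    _ = ∑' n, ∑' z : V, φ n z := ENNReal.tsum_comm
    _ = ∑' n, ∑' z : V, φ (n + 1) z := by
        rw [tsum_eq_zero_add' ENNReal.summable]
        have h0 : ∑' z : V, φ 0 z = 0 := ENNReal.tsum_eq_zero.2 fun z =>
          walkProb_atAfterAvoiding_zero A fun h => hx (h ▸ z.2)
        rw [h0, zero_add]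
    _ ≤ ∑' z, F z * φ 1 z :=
        ENNReal.tsum_le_of_sum_range_le fun n => le_add_self.trans (hpartial n)
    _ ≤ _ := hone

/-! ### A superharmonic function in a cone -/

/-- The sum `∑_{k < n} (1 + 1/2 + ⋯ + 1/k)` of the first `n` harmonic numbers, a discrete analogue
of `n log n`. -/
noncomputable def harmonicSum (n : ℕ) : ℝ :=
  ∑ k ∈ Finset.range n, ∑ j ∈ Finset.range k, (1 : ℝ) / (j + 1)

theorem partialHarmonic_nonneg (k : ℕ) : 0 ≤ ∑ j ∈ Finset.range k, (1 : ℝ) / (j + 1) :=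
  Finset.sum_nonneg fun _ _ => by positivity

theorem harmonicSum_mono : Monotone harmonicSum := fun _ _ h =>
  Finset.sum_le_sum_of_subset_of_nonneg (Finset.range_subset_range.2 h) fun _ _ _ =>
    partialHarmonic_nonneg _

theorem harmonicSum_nonneg (n : ℕ) : 0 ≤ harmonicSum n :=
  Finset.sum_nonneg fun _ _ => partialHarmonic_nonneg _

theorem harmonicSum_second_difference (n : ℕ) :
    harmonicSum (n + 2) + harmonicSum n = 2 * harmonicSum (n + 1) + 1 / (n + 1) := by
  simp only [harmonicSum, Finset.sum_range_succ]
  ring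

theorem tendsto_harmonicSum_div_atTop :
    Tendsto (fun n : ℕ => harmonicSum n / n) atTop atTop := by
  refine tendsto_atTop.2 fun R => ?_
  obtain ⟨m, hm⟩ := (tendsto_atTop.1 Real.tendsto_sum_range_one_div_nat_succ_atTop
    (2 * max R 0)).exists
  filter_upwards [eventually_ge_atTop (2 * m + 1)] with n hn
  have hn0 : (0 : ℝ) < n := by exact_mod_cast (by omega : 0 < n)
  have hmn : (2 * m + 1 : ℝ) ≤ n := by exact_mod_cast hn
  -- The last `n - m ≥ n / 2` summands are each at least `2 R`.
  have hsum : (n - m : ℝ) * (2 * max R 0) ≤ harmonicSum n := by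
    calc (n - m : ℝ) * (2 * max R 0) = ∑ _k ∈ Finset.Ico m n, 2 * max R 0 := by
          rw [Finset.sum_const, Nat.card_Ico, nsmul_eq_mul, Nat.cast_sub (by omega)]
      _ ≤ ∑ k ∈ Finset.Ico m n, ∑ j ∈ Finset.range k, (1 : ℝ) / (j + 1) := by
          refine Finset.sum_le_sum fun k hk => hm.trans ?_
          exact Finset.sum_le_sum_of_subset_of_nonneg
            (Finset.range_subset_range.2 (Finset.mem_Ico.1 hk).1) fun _ _ _ => by positivity
      _ ≤ harmonicSum n := by
          refine Finset.sum_le_sum_of_subset_of_nonneg (fun k hk => ?_) fun _ _ _ =>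
            partialHarmonic_nonneg _
          exact Finset.mem_range.2 (Finset.mem_Ico.1 hk).2
  rw [le_div_iff₀ hn0]
  nlinarith [le_max_left R 0, le_max_right R 0]

/-- A discrete analogue of `K y + y log y - x² / y`. It is superharmonic in `{y ≥ 1}`, and for
large `K` it is at least `harmonicSum y` in a cone `{|x| ≤ C (y + 1)}`. -/
noncomputable def conePotential (K : ℝ) (z : ℤ × ℤ) : ℝ :=
  K * (z.2 + 1) + harmonicSum z.2.toNat - (z.1 : ℝ) ^ 2 / (z.2 + 1)

theorem sum_conePotential_le (K : ℝ) (x y : ℤ) (hy : 1 ≤ y) :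
    conePotential K (x + 1, y) + conePotential K (x - 1, y) + conePotential K (x, y + 1) +
      conePotential K (x, y - 1) ≤ 4 * conePotential K (x, y) := by
  obtain ⟨k, rfl⟩ : ∃ k : ℕ, y = k + 1 := ⟨(y - 1).toNat, by omega⟩
  have h0 : ((k : ℤ) + 1 - 1).toNat = k := by omega
  have h1 : ((k : ℤ) + 1).toNat = k + 1 := by omega
  have h2 : ((k : ℤ) + 1 + 1).toNat = k + 2 := by omega
  simp only [conePotential, h0, h1, h2]
  push_cast
  have hsd := harmonicSum_second_difference k
  have hk : (0 : ℝ) ≤ k := Nat.cast_nonneg k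
  -- The harmonic part contributes `1 / y`, the horizontal second difference of `x² / (y + 1)` is
  -- `2 / (y + 1)`, and its vertical second difference is nonnegative by convexity.
  have ha : (1 : ℝ) / (k + 1) ≤ 2 / (k + 1 + 1) := by
    rw [div_le_div_iff₀ (by positivity) (by positivity)]
    linarith
  have hb : (2 : ℝ) / (k + 1 + 1) ≤ 1 / (k + 1 + 1 + 1) + 1 / (k + 1) := by
    rw [div_add_div _ _ (by positivity) (by positivity),
      div_le_div_iff₀ (by positivity) (by positivity)]
    nlinarith
  have hc := mul_le_mul_of_nonneg_left hb (sq_nonneg (x : ℝ))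
  have hd : ((x : ℝ) + 1) ^ 2 / (k + 1 + 1) + ((x : ℝ) - 1) ^ 2 / (k + 1 + 1) =
      2 * ((x : ℝ) ^ 2 / (k + 1 + 1)) + 2 / (k + 1 + 1) := by
    ring
  have he : (x : ℝ) ^ 2 * (1 / (k + 1 + 1 + 1) + 1 / (k + 1)) =
      (x : ℝ) ^ 2 / (k + 1 + 1 + 1) + (x : ℝ) ^ 2 / (k + 1) := by
    ring
  have hf : (x : ℝ) ^ 2 * (2 / (k + 1 + 1)) = 2 * ((x : ℝ) ^ 2 / (k + 1 + 1)) := by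
    ring
  have hg : (k : ℝ) + 1 - 1 + 1 = k + 1 := by ring
  rw [hg]
  linarith

theorem harmonicSum_le_conePotential {C : ℝ} {z : ℤ × ℤ} (hy : 0 ≤ z.2)
    (hz : |(z.1 : ℝ)| ≤ C * (z.2 + 1)) : harmonicSum z.2.toNat ≤ conePotential (C ^ 2) z := by
  have hy' : (0 : ℝ) < z.2 + 1 := by exact_mod_cast (by omega : 0 < z.2 + 1)
  have h : (z.1 : ℝ) ^ 2 / (z.2 + 1) ≤ C ^ 2 * (z.2 + 1) := by
    rw [div_le_iff₀ hy', ← sq_abs]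
    nlinarith [abs_nonneg (z.1 : ℝ)]
  rw [conePotential]
  linarith

theorem sum_unitSteps {M : Type*} [AddCommMonoid M] (f : ℤ × ℤ → M) (x y : ℤ) :
    ∑ e ∈ unitSteps, f ((x, y) - e) =
      f (x - 1, y) + (f (x + 1, y) + (f (x, y - 1) + f (x, y + 1))) := by
  rw [unitSteps, Finset.sum_insert (by decide), Finset.sum_insert (by decide),
    Finset.sum_insert (by decide), Finset.sum_singleton]
  simp

/-! ### The supersolution for the visits to a horizontal line -/

open Classical in
/-- The truncated potential `min (l u) (4 y) (4 N)`, with `u` a `conePotential`, restricted to the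
points of the open upper half plane outside `B`. The function `4 min(y, N)` solves the
corresponding problem for visits to the line of height `N` in the half plane. -/
noncomputable def lineSupersolution (B : Set (ℤ × ℤ)) (K l : ℝ) (N : ℕ) (z : ℤ × ℤ) : ℝ :=
  if z ∉ B ∧ 1 ≤ z.2 then min (l * conePotential K z) (4 * min (z.2 : ℝ) N) else 0

variable {B : Set (ℤ × ℤ)} {K l C : ℝ} {N : ℕ}

theorem lineSupersolution_of_nonpos {z : ℤ × ℤ} (hz : z.2 ≤ 0) :
    lineSupersolution B K l N z = 0 :=
  if_neg fun h => by have := h.2; omega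

theorem lineSupersolution_le (hl : 0 ≤ l) {z : ℤ × ℤ} (hy : 0 ≤ z.2)
    (hz : |(z.1 : ℝ)| ≤ C * (z.2 + 1)) :
    lineSupersolution B (C ^ 2) l N z ≤ l * conePotential (C ^ 2) z ∧
      lineSupersolution B (C ^ 2) l N z ≤ 4 * z.2 ∧ lineSupersolution B (C ^ 2) l N z ≤ 4 * N := by
  have hy' : (0 : ℝ) ≤ z.2 := by exact_mod_cast hy
  have hu : 0 ≤ l * conePotential (C ^ 2) z :=
    mul_nonneg hl ((harmonicSum_nonneg _).trans (harmonicSum_le_conePotential hy hz))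
  rw [lineSupersolution]
  split_ifs
  · exact ⟨min_le_left _ _,
      (min_le_right _ _).trans (mul_le_mul_of_nonneg_left (min_le_left _ _) (by norm_num)),
      (min_le_right _ _).trans (mul_le_mul_of_nonneg_left (min_le_right _ _) (by norm_num))⟩
  · exact ⟨hu, by positivity, by positivity⟩

theorem lineSupersolution_nonneg (hl : 0 ≤ l) (hC : 0 ≤ C)
    (hcone : ∀ z : ℤ × ℤ, z ∉ B → 1 ≤ z.2 → |(z.1 : ℝ)| ≤ C * z.2) (z : ℤ × ℤ) :
    0 ≤ lineSupersolution B (C ^ 2) l N z := by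
  rw [lineSupersolution]
  split_ifs with h
  · have hy : (1 : ℝ) ≤ z.2 := by exact_mod_cast h.2
    refine le_min (mul_nonneg hl ?_) (by positivity)
    refine (harmonicSum_nonneg _).trans (harmonicSum_le_conePotential (by omega) ?_)
    exact (hcone z h.1 h.2).trans (by nlinarith)
  · exact le_rfl

/-- Off `B` and the axis, the supersolution exceeds its average by `1` on the line of height `N`.
The hypothesis on `l` makes the truncation at `4 N` active on and above that line. -/
theorem lineSupersolution_superharmonic (hl : 0 ≤ l) (hC : 1 ≤ C) (hN : 1 ≤ N)
    (hlN : 4 * N ≤ l * harmonicSum N)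
    (hcone : ∀ z : ℤ × ℤ, z ∉ B → 1 ≤ z.2 → |(z.1 : ℝ)| ≤ (C - 1) * z.2)
    {x y : ℤ} (hB : (x, y) ∉ B) (hy0 : y ≠ 0) :
    lineSupersolution B (C ^ 2) l N (x - 1, y) + (lineSupersolution B (C ^ 2) l N (x + 1, y) +
      (lineSupersolution B (C ^ 2) l N (x, y - 1) + lineSupersolution B (C ^ 2) l N (x, y + 1))) +
      4 * (horizontalLine N).indicator (fun _ => 1) (x, y) ≤
      4 * lineSupersolution B (C ^ 2) l N (x, y) := by
  rcases lt_or_gt_of_ne hy0 with hy | hy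
  · have hline : (x, y) ∉ horizontalLine N := by simp only [horizontalLine, Set.mem_ofPred_eq]; omega
    have h (a b : ℤ) (hb : b ≤ 0) : lineSupersolution B (C ^ 2) l N (a, b) = 0 :=
      lineSupersolution_of_nonpos hb
    rw [Set.indicator_of_notMem hline, h _ _ hy.le, h _ _ hy.le, h x y hy.le,
      h _ _ (by omega : y - 1 ≤ 0), h _ _ (by omega : y + 1 ≤ 0)]
    norm_num
  have hy1 : 1 ≤ y := hy
  have hyr : (1 : ℝ) ≤ y := by exact_mod_cast hy1
  have hx : |(x : ℝ)| ≤ (C - 1) * y := hcone (x, y) hB hy1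
  obtain ⟨hx1, hx2⟩ := abs_le.1 hx
  obtain ⟨a1, a2, a3⟩ := lineSupersolution_le (B := B) (N := N) (C := C) (z := (x - 1, y)) hl
    (by dsimp only; omega) (by push_cast; rw [abs_le]; constructor <;> nlinarith)
  obtain ⟨b1, b2, b3⟩ := lineSupersolution_le (B := B) (N := N) (C := C) (z := (x + 1, y)) hl
    (by dsimp only; omega) (by push_cast; rw [abs_le]; constructor <;> nlinarith)
  obtain ⟨c1, c2, c3⟩ := lineSupersolution_le (B := B) (N := N) (C := C) (z := (x, y - 1)) hl
    (by dsimp only; omega) (by push_cast; rw [abs_le]; constructor <;> nlinarith)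
  obtain ⟨d1, d2, d3⟩ := lineSupersolution_le (B := B) (N := N) (C := C) (z := (x, y + 1)) hl
    (by dsimp only; omega) (by push_cast; rw [abs_le]; constructor <;> nlinarith)
  have hu := mul_le_mul_of_nonneg_left (sum_conePotential_le (C ^ 2) x y hy1) hl
  have hval : lineSupersolution B (C ^ 2) l N (x, y) =
      min (l * conePotential (C ^ 2) (x, y)) (4 * min (y : ℝ) N) := if_pos ⟨hB, hy1⟩
  push_cast at a2 b2 c2 d2
  have htop (h : (N : ℤ) ≤ y) : 4 * (N : ℝ) ≤ l * conePotential (C ^ 2) (x, y) := by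
    refine hlN.trans (mul_le_mul_of_nonneg_left ?_ hl)
    refine (harmonicSum_mono (by omega : N ≤ y.toNat)).trans ?_
    exact harmonicSum_le_conePotential (z := (x, y)) (by dsimp only; omega)
      (hx.trans (by dsimp only; nlinarith))
  rw [hval]
  rcases lt_trichotomy y N with h | h | h
  · have hline : (x, y) ∉ horizontalLine N := by simp only [horizontalLine, Set.mem_ofPred_eq]; omega
    have hNr : (y : ℝ) ≤ N := by exact_mod_cast h.le
    rw [Set.indicator_of_notMem hline, min_eq_left hNr]
    rcases min_choice (l * conePotential (C ^ 2) (x, y)) (4 * (y : ℝ)) with hm | hm <;> rw [hm] <;>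
      linarith
  · have hline : (x, y) ∈ horizontalLine N := h
    have hNr : (y : ℝ) = N := by exact_mod_cast h
    rw [Set.indicator_of_mem hline, hNr, min_self, min_eq_right (htop h.ge)]
    rw [hNr] at c2
    linarith
  · have hline : (x, y) ∉ horizontalLine N := by simp only [horizontalLine, Set.mem_ofPred_eq]; omega
    have hNr : (N : ℝ) ≤ y := by exact_mod_cast h.le
    rw [Set.indicator_of_notMem hline, min_eq_right hNr, min_eq_right (htop h.le)]
    linarith

/-! ### Vanishing of the stationary harmonic measure -/

theorem harmonicMeasureFrom_le {x : ℤ × ℤ} (hxB : x ∈ B) (hl : 0 ≤ l) (hC : 1 ≤ C) (hN : 1 ≤ N)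
    (hlN : 4 * N ≤ l * harmonicSum N)
    (hcone : ∀ z : ℤ × ℤ, z ∉ B → 1 ≤ z.2 → |(z.1 : ℝ)| ≤ (C - 1) * z.2) :
    harmonicMeasureFrom B N x ≤
      ENNReal.ofReal (l * ∑ e ∈ unitSteps, |conePotential (C ^ 2) (x - e)|) := by
  have hcone' (z : ℤ × ℤ) (hz : z ∉ B) (hz' : 1 ≤ z.2) : |(z.1 : ℝ)| ≤ C * z.2 := by
    have : (1 : ℝ) ≤ z.2 := by exact_mod_cast hz'
    exact (hcone z hz hz').trans (by nlinarith)
  set f := lineSupersolution B (C ^ 2) l N with hf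
  have hf0 (z : ℤ × ℤ) : 0 ≤ f z := lineSupersolution_nonneg hl (by linarith) hcone' z
  have havg (z : ℤ × ℤ) : ∑ e ∈ unitSteps, (4 : ℝ≥0∞)⁻¹ * ENNReal.ofReal (f (z - e)) =
      ENNReal.ofReal (4⁻¹ * ∑ e ∈ unitSteps, f (z - e)) := by
    rw [← Finset.mul_sum, ENNReal.ofReal_mul (by norm_num),
      ENNReal.ofReal_sum_of_nonneg fun e _ => hf0 _, ENNReal.ofReal_inv_of_pos (by norm_num)]
    norm_num
  refine (tsum_walkProb_firstHitAt_le (A := B ∪ horizontalLine 0) (V := horizontalLine N \ B)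
    (fun h => h.2 hxB) ?_ (fun z => ENNReal.ofReal (f z)) ?_).trans ?_
  · refine Set.disjoint_left.2 fun z hz hz' => hz'.elim hz.2 fun h0 => ?_
    have h1 : z.2 = N := hz.1
    have h2 : z.2 = (0 : ℕ) := h0
    omega
  · rintro ⟨a, b⟩ hz
    have hzB : (a, b) ∉ B := fun h => hz (Or.inl h)
    have hb : b ≠ 0 := fun h => hz (Or.inr h)
    have hind : (horizontalLine N \ B).indicator (fun _ => (1 : ℝ≥0∞)) (a, b) =
        ENNReal.ofReal ((horizontalLine N).indicator (fun _ => 1) (a, b)) := by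
      by_cases h : (a, b) ∈ horizontalLine N <;> simp [h, hzB]
    have hmain := lineSupersolution_superharmonic hl hC hN hlN hcone hzB hb
    rw [havg, hind, ← ENNReal.ofReal_add (mul_nonneg (by norm_num)
      (Finset.sum_nonneg fun e _ => hf0 _)) (Set.indicator_nonneg (fun _ _ => zero_le_one) _)]
    refine ENNReal.ofReal_le_ofReal ?_
    rw [sum_unitSteps f a b]
    linarith
  · rw [havg, Finset.mul_sum, Finset.mul_sum]
    refine ENNReal.ofReal_le_ofReal (Finset.sum_le_sum fun e _ => ?_)
    have hle : f (x - e) ≤ l * |conePotential (C ^ 2) (x - e)| := by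
      rw [hf, lineSupersolution]
      split_ifs
      · exact (min_le_left _ _).trans (mul_le_mul_of_nonneg_left (le_abs_self _) hl)
      · positivity
    linarith [hf0 (x - e)]

/-- Under horizontal super-linear growth the complement of `B` lies in a cone. -/
theorem HasHorizontalSuperLinearGrowth.exists_cone (h : HasHorizontalSuperLinearGrowth B) :
    ∃ C : ℝ, 0 ≤ C ∧ ∀ z : ℤ × ℤ, z ∉ B → 1 ≤ z.2 → |(z.1 : ℝ)| ≤ C * z.2 := by
  obtain ⟨c, hc, M, hM⟩ := h
  refine ⟨max |M| c⁻¹, le_max_of_le_left (abs_nonneg M), ?_⟩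
  rintro ⟨a, b⟩ hz hb
  dsimp only at hb ⊢
  have hbr : (1 : ℝ) ≤ b := by exact_mod_cast hb
  rcases lt_or_ge |(a : ℝ)| M with ha | ha
  · have h1 : M ≤ max |M| c⁻¹ := (le_abs_self M).trans (le_max_left _ _)
    nlinarith [abs_nonneg (a : ℝ)]
  · have hcol : columnHeight B a ≤ ENNReal.ofReal b := by
      refine iSup₂_le fun m hm => ?_
      have hmb : (m : ℤ) ≤ b := by
        by_contra hlt
        exact hz (hm b hb (by omega))
      rw [← ENNReal.ofReal_natCast]
      exact ENNReal.ofReal_le_ofReal (by exact_mod_cast hmb)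
    have hle : c * |(a : ℝ)| ≤ b := by
      have := (ENNReal.ofReal_le_ofReal_iff (by linarith)).1 ((hM a ha).trans hcol)
      rwa [abs_mul, abs_of_pos hc] at this
    calc |(a : ℝ)| = c⁻¹ * (c * |(a : ℝ)|) := by rw [inv_mul_cancel_left₀ hc.ne']
      _ ≤ c⁻¹ * b := mul_le_mul_of_nonneg_left hle (inv_nonneg.2 hc.le)
      _ ≤ max |M| c⁻¹ * b := mul_le_mul_of_nonneg_right (le_max_right _ _) (by linarith)

theorem HasHorizontalSuperLinearGrowth.hasStationaryHarmonicMeasure_zero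
    (h : HasHorizontalSuperLinearGrowth B) {x : ℤ × ℤ} (hx : x ∈ B) :
    HasStationaryHarmonicMeasure B x 0 := by
  obtain ⟨C, hC, hcone⟩ := h.exists_cone
  set S := ∑ e ∈ unitSteps, |conePotential ((C + 1) ^ 2) (x - e)|
  -- The smallest multiple for which the cone potential dominates `4 N` on the line of height `N`.
  have hlim : Tendsto (fun N : ℕ => 4 * (harmonicSum N / N)⁻¹ * S) atTop (𝓝 0) := by
    simpa using (tendsto_harmonicSum_div_atTop.inv_tendsto_atTop.const_mul 4).mul_const S
  have hlim' := ENNReal.tendsto_ofReal hlim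
  rw [ENNReal.ofReal_zero] at hlim'
  refine tendsto_of_tendsto_of_tendsto_of_le_of_le' tendsto_const_nhds hlim'
    (Eventually.of_forall fun _ => zero_le) ?_
  filter_upwards [eventually_ge_atTop 1, tendsto_harmonicSum_div_atTop.eventually_gt_atTop 0]
    with N hN hpos
  have hNr : (0 : ℝ) < N := by exact_mod_cast hN
  have hG : 0 < harmonicSum N := by
    have := mul_pos hpos hNr
    rwa [div_mul_cancel₀ _ hNr.ne'] at this
  refine harmonicMeasureFrom_le hx (by positivity) (by linarith) hN ?_ (by simpa using hcone)
  rw [inv_div, mul_assoc, div_mul_cancel₀ _ hG.ne']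

theorem hasHorizontalSuperLinearGrowth_exponentialColumns :
    HasHorizontalSuperLinearGrowth exponentialColumns := by
  refine ⟨1, one_pos, 0, fun a _ => ?_⟩
  have h : ∀ k : ℤ, 1 ≤ k → k ≤ (a.natAbs : ℤ) → (a, k) ∈ exponentialColumns := fun k hk hka =>
    ⟨by dsimp only; omega, hka.trans (by exact_mod_cast Nat.lt_two_pow_self.le)⟩
  refine le_trans (le_of_eq ?_) (le_iSup₂ (f := fun (m : ℕ) (_ : ∀ k : ℤ, 1 ≤ k → k ≤ (m : ℤ) →
    (a, k) ∈ exponentialColumns) => (m : ℝ≥0∞)) a.natAbs h)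
  rw [one_mul, ← ENNReal.ofReal_natCast, Nat.cast_natAbs, Int.cast_abs]

theorem theorem1 :
    (∀ B : Set (ℤ × ℤ), B ⊆ upperHalfLattice → HasHorizontalSuperLinearGrowth B →
      ∀ x ∈ B, HasStationaryHarmonicMeasure B x 0) ∧
    (∀ x ∈ exponentialColumns, HasStationaryHarmonicMeasure exponentialColumns x 0) := by
  exact ⟨fun _ _ hB _ hx => hB.hasStationaryHarmonicMeasure_zero hx, fun _ hx =>
    hasHorizontalSuperLinearGrowth_exponentialColumns.hasStationaryHarmonicMeasure_zero hx⟩
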